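/- Let $d\ge 1$, let $\beta\in(0,1)$, and let $y=(y_1,\dots,y_d)$ be a random vector with Gaussian law $\mathcal N(\bar y,\Sigma)$, where $\bar y\in\mathbb R^d$ and $\Sigma$ is a symmetric positive semidefinite matrix with positive diagonal entries (for instance, any positive definite matrix). Put $\sigma_i=\sqrt{\Sigma_{ii}}$ and $r_i=-\bar y_i/\sigma_i$ for $1\le i\le d$. Let $\tilde r_1\le\dots\le\tilde r_d$ be the numbers $r_1,\dots,r_d$ in increasing order, and let $\tilde r_0=0$. Let $\Phi_d$ be the cumulative distribution function of the chi-squared distribution with $d$ degrees of freedom. Let $\Psi_d(r)=1-\Phi_d(r^2)$ for $r\ge 0$, $\Psi_d(r)=1$ for $r<0$, and $\Delta\Psi_d(R_1,R_2)=\Psi_d(R_1)-\Psi_d(R_2)$. Let $I_x(a,b)=\frac{1}{B(a,b)}\int_0^x t^{a-1}(1-t)^{b-1}\,dt$ be the regularized incomplete beta function for $0\le x\le 1$, with $I_x(a,b)=0$ for $x<0$, and let $\mathcal I(x)=I_{1-x^2}\left(\frac{d-1}{2},\frac12\right)$. Define $$\beta_{\mathrm T,d}=1-\sum_{i=1}^{d}\Delta\Psi_d(\tilde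 r_{i-1},\tilde r_i)\,\max\left[0,\;1-\frac12\sum_{j=1}^{i-1}\mathcal I\left(\frac{\tilde r_j}{\tilde r_i}\right)\right],$$ where a summand with $\tilde r_i=0$ is read as $0$ (its first factor vanishes). Suppose that for some $j\in\{1,\dots,d\}$ one has $\bar y_j\ne 0$, $\beta_{\mathrm T,d}\,|\bar y_j|\le-\beta\,\bar y_j$, and $\bar y_i\le 0$ for all $i\ne j$. Then $$\mathbb P\left(y_i\le 0\text{ for all } i\in\{1,\dots,d\}\right)\ge 1-\beta .$$ -/

import Mathlib

open MeasureTheory ProbabilityTheory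

noncomputable section

namespace ChanceConstraint

/-- The chi-squared distribution with `d` degrees of freedom: the law of the sum of the squares
of `d` independent standard normal variables. -/
def chiSquared (d : ℕ) : Measure ℝ :=
  (Measure.pi fun _ : Fin d ↦ gaussianReal 0 1).map fun z ↦ ∑ i, z i ^ 2

/-- `Φ_d`, the cumulative distribution function of the chi-squared distribution. -/
def Phi (d : ℕ) (x : ℝ) : ℝ := cdf (chiSquared d) x

/-- `Ψ_d (r) = 1 - Φ_d (r ^ 2)` for `r ≥ 0`, and `Ψ_d (r) = 1` for `r < 0`. -/
def Psi (d : ℕ) (r : ℝ) : ℝ := if 0 ≤ r then 1 - Phi d (r ^ 2) else 1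

/-- `ΔΨ_d (R₁, R₂) = Ψ_d (R₁) - Ψ_d (R₂)`. -/
def deltaPsi (d : ℕ) (R₁ R₂ : ℝ) : ℝ := Psi d R₁ - Psi d R₂

/-- The regularized incomplete Euler beta function `I_x (a, b)`, for `a, b > 0` and `x ≤ 1`.
It is the cumulative distribution function of the beta distribution, so it vanishes for `x ≤ 0`. -/
def regIncBeta (x a b : ℝ) : ℝ :=
  (∫ t in Set.Ioo 0 x, t ^ (a - 1) * (1 - t) ^ (b - 1)) / beta a b

/-- `𝓘 (x) = I_{1 - x ^ 2} ((d - 1) / 2, 1 / 2)`: for `0 ≤ θ ≤ π / 2`, half of `𝓘 (cos θ)` is the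
proportion of a ball of `ℝ ^ d` that is covered by a spherical sector of half-angle `θ`. -/
def sectorI (d : ℕ) (x : ℝ) : ℝ := regIncBeta (1 - x ^ 2) (((d : ℝ) - 1) / 2) (1 / 2)

/-- The vector of the signed Mahalanobis distances `r_i = - ȳ_i / σ_i` from the mean to the
constraints, where `σ_i` is the square root of the `i`-th diagonal entry of the covariance. -/
def mahalanobis {d : ℕ} (ybar : EuclideanSpace ℝ (Fin d)) (S : Matrix (Fin d) (Fin d) ℝ) :
    Fin d → ℝ :=
  fun i ↦ -ybar i / √(S i i)

/-- The increasing rearrangement `r̃_1 ≤ ⋯ ≤ r̃_d` of `r`, with the convention `r̃_0 = 0`.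
The indices above `d` are not used. -/
def sorted {d : ℕ} (r : Fin d → ℝ) : ℕ → ℝ
  | 0 => 0
  | k + 1 => if h : k < d then r (Tuple.sort r ⟨k, h⟩) else 0

/-- The `d`-th-order failure risk estimation `β_{T,d}`. When `r̃_i = 0`, the factor
`ΔΨ_d (r̃_{i-1}, r̃_i)` is zero, so that the value given to the quotient `r̃_j / r̃_i` is
irrelevant. -/
def betaT {d : ℕ} (ybar : EuclideanSpace ℝ (Fin d)) (S : Matrix (Fin d) (Fin d) ℝ) : ℝ :=
  let rt := sorted (mahalanobis ybar S)
  1 - ∑ i ∈ Finset.Icc 1 d, deltaPsi d (rt (i - 1)) (rt i) *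
    max 0 (1 - 1 / 2 * ∑ j ∈ Finset.Icc 1 (i - 1), sectorI d (rt j / rt i))

end ChanceConstraint

end

open scoped ENNReal RealInnerProductSpace

namespace ChanceConstraint

/-! Write `y = ȳ + A z` with `A = √Σ` and `z` standard Gaussian. Constraint `i` becomes `⟪u i, z⟫ ≤
r i` with `u i` a unit vector. As `betaT` is nonnegative, the risk condition forces `ȳ j < 0`; hence
every `r i ≥ 0` and `betaT ≤ β`, and it remains to bound the Gaussian mass of a polyhedron below by
`1 - betaT`.

Cut space into the shells `r̃_{i-1} < ‖z‖ ≤ r̃_i`, of mass `ΔΨ`, and discard the exterior. In shell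
`i`, Cauchy–Schwarz gives all constraints `k ≥ i`. A violated constraint `k < i` puts `z` in the
cone `⟪v k, z⟫ > (r̃_k / r̃_i) ‖z‖`, which takes at most the proportion `𝓘 (r̃_k / r̃_i) / 2` of the
shell. A union bound in each shell and a sum over shells conclude
(`sum_deltaPsi_le_stdGaussian_real`).

The cone bound (`stdGaussian_real_cone_le`) rests on the independence of `‖z‖ ^ 2` and `1 - ⟪u, z⟫ ^
2 / ‖z‖ ^ 2`, the latter with a beta law, derived from gamma variables. -/

/-! ### Sums and ratios of independent gamma variables -/

lemma lintegral_comp_mul_left_of_pos (f : ℝ → ℝ≥0∞) {s : ℝ} (hs : 0 < s) :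
    ∫⁻ w, f w = ∫⁻ t, ENNReal.ofReal s * f (s * t) := by
  have h := lintegral_image_eq_lintegral_abs_deriv_mul (s := Set.univ) (f := fun t ↦ s * t)
    (f' := fun _ ↦ s) MeasurableSet.univ
    (fun x _ ↦ (hasDerivAt_const_mul s).hasDerivWithinAt)
    (fun x _ y _ h ↦ mul_left_cancel₀ hs.ne' h) f
  have himg : (fun t ↦ s * t) '' Set.univ = Set.univ := by
    rw [Set.image_univ]
    exact (mul_left_surjective₀ hs.ne').range_eq
  simpa [himg, abs_of_pos hs] using h

/-- Density identity for the substitution `x = s (1 - t)`, `w = s t`, whose Jacobian is `s`. The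
endpoints are excluded because `betaPDF` vanishes there while `gammaPDF` at `0` need not. -/
lemma gammaPDF_mul_gammaPDF {a b r s t : ℝ} (ha : 0 < a) (hb : 0 < b) (hr : 0 < r) (hs : 0 < s)
    (ht0 : t ≠ 0) (ht1 : t ≠ 1) :
    ENNReal.ofReal s * (gammaPDF a r (s - s * t) * gammaPDF b r (s * t)) =
      gammaPDF (a + b) r s * betaPDF b a t := by
  rcases lt_or_gt_of_ne ht0 with h0 | h0
  · rw [gammaPDF_of_neg (x := s * t) (mul_neg_of_pos_of_neg hs h0),
      betaPDF_eq_zero_of_nonpos h0.le, mul_zero, mul_zero, mul_zero]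
  rcases lt_or_gt_of_ne ht1 with h1 | h1
  · have h1' : 0 < 1 - t := by linarith
    have e : s - s * t = s * (1 - t) := by ring
    have hΓa := Real.Gamma_pos_of_pos ha
    have hΓb := Real.Gamma_pos_of_pos hb
    have hΓ := Real.Gamma_pos_of_pos (add_pos ha hb)
    rw [e, gammaPDF_of_nonneg (mul_pos hs h1').le, gammaPDF_of_nonneg (mul_pos hs h0).le,
      gammaPDF_of_nonneg hs.le, betaPDF_of_pos_lt_one h0 h1, ← ENNReal.ofReal_mul (by positivity),
      ← ENNReal.ofReal_mul hs.le, ← ENNReal.ofReal_mul (by positivity)]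
    congr 1
    have hexp : Real.exp (-(r * s)) =
        Real.exp (-(r * (s * (1 - t)))) * Real.exp (-(r * (s * t))) := by
      rw [← Real.exp_add]; congr 1; ring
    have hpow : s ^ (a + b - 1) = s * (s ^ (a - 1) * s ^ (b - 1)) := by
      rw [← Real.rpow_add hs]
      nth_rw 2 [← Real.rpow_one s]
      rw [← Real.rpow_add hs]; congr 1; ring
    rw [hexp, hpow, Real.mul_rpow hs.le h1'.le, Real.mul_rpow hs.le h0.le, Real.rpow_add hr, beta,
      add_comm b a]
    field_simp
  · rw [gammaPDF_of_neg (x := s - s * t) (by nlinarith), betaPDF_eq_zero_of_one_le h1.le, zero_mul,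
      mul_zero, mul_zero]

lemma measurable_gammaPDF (a r : ℝ) : Measurable (gammaPDF a r) :=
  (measurable_gammaPDFReal a r).ennreal_ofReal

lemma measurable_betaPDF (a b : ℝ) : Measurable (betaPDF a b) :=
  (measurable_betaPDFReal a b).ennreal_ofReal

lemma lintegral_gammaPDF_prod {a b r : ℝ} (ha : 0 < a) (hb : 0 < b) (hr : 0 < r)
    {f : ℝ × ℝ → ℝ≥0∞} (hf : Measurable f) :
    ∫⁻ w, ∫⁻ x, gammaPDF a r x * gammaPDF b r w * f (x + w, w / (x + w)) =
      ∫⁻ s, ∫⁻ t, gammaPDF (a + b) r s * betaPDF b a t * f (s, t) := by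
  have hga := measurable_gammaPDF a r
  have hgb := measurable_gammaPDF b r
  calc
    -- The planar substitution is done one variable at a time: shift `x = s - w`, exchange the
    -- integrals, then scale `w = s t`.
    _ = ∫⁻ w, ∫⁻ s, gammaPDF a r (s - w) * gammaPDF b r w * f (s, w / s) := by
      refine lintegral_congr fun w ↦ ?_
      rw [← lintegral_add_right_eq_self
        (fun s ↦ gammaPDF a r (s - w) * gammaPDF b r w * f (s, w / s)) w]
      simp
    _ = ∫⁻ s, ∫⁻ w, gammaPDF a r (s - w) * gammaPDF b r w * f (s, w / s) := by
      refine lintegral_lintegral_swap (Measurable.aemeasurable ?_)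
      unfold Function.uncurry
      fun_prop
    _ = _ := by
      refine lintegral_congr_ae ?_
      filter_upwards [Measure.ae_ne volume (0 : ℝ)] with s hs
      rcases lt_or_gt_of_ne hs with hs | hs
      · have h1 : ∀ t, gammaPDF (a + b) r s * betaPDF b a t * f (s, t) = 0 := fun t ↦ by
          rw [gammaPDF_of_neg hs, zero_mul, zero_mul]
        have h2 : ∀ w, gammaPDF a r (s - w) * gammaPDF b r w * f (s, w / s) = 0 := fun w ↦ by
          rcases lt_or_ge w 0 with hw | hw
          · rw [gammaPDF_of_neg hw, mul_zero, zero_mul]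
          · rw [gammaPDF_of_neg (by linarith : s - w < 0), zero_mul, zero_mul]
        simp_rw [h1, h2]
      · rw [lintegral_comp_mul_left_of_pos _ hs]
        refine lintegral_congr_ae ?_
        filter_upwards [Measure.ae_ne volume (0 : ℝ), Measure.ae_ne volume (1 : ℝ)] with t h0 h1
        rw [← mul_assoc, gammaPDF_mul_gammaPDF ha hb hr hs h0 h1, mul_div_cancel_left₀ t hs.ne']

/-- If `X` and `W` are independent gamma variables, then `X + W` and `W / (X + W)` are
independent, with a gamma and a beta law. -/
lemma map_gammaMeasure_prod {a b r : ℝ} (ha : 0 < a) (hb : 0 < b) (hr : 0 < r) :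
    ((gammaMeasure a r).prod (gammaMeasure b r)).map (fun p ↦ (p.1 + p.2, p.2 / (p.1 + p.2))) =
      (gammaMeasure (a + b) r).prod (betaMeasure b a) := by
  have hga := measurable_gammaPDF a r
  have hgb := measurable_gammaPDF b r
  have hgab := measurable_gammaPDF (a + b) r
  have hba := measurable_betaPDF b a
  have := isProbabilityMeasure_gammaMeasure ha hr
  have := isProbabilityMeasure_gammaMeasure hb hr
  have := isProbabilityMeasure_gammaMeasure (add_pos ha hb) hr
  have := isProbabilityMeasureBeta hb ha
  refine Measure.ext_of_lintegral _ fun f hf ↦ ?_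
  rw [lintegral_map hf (by fun_prop), lintegral_prod_symm _ (by fun_prop),
    lintegral_prod _ hf.aemeasurable]
  simp only [gammaMeasure, betaMeasure]
  rw [lintegral_withDensity_eq_lintegral_mul _ hgb (by fun_prop),
    lintegral_withDensity_eq_lintegral_mul _ hgab (by fun_prop)]
  simp only [Pi.mul_apply]
  have h1 : ∀ w, gammaPDF b r w *
      ∫⁻ x, f (x + w, w / (x + w)) ∂(volume.withDensity (gammaPDF a r)) =
      ∫⁻ x, gammaPDF a r x * gammaPDF b r w * f (x + w, w / (x + w)) := fun w ↦ by
    rw [lintegral_withDensity_eq_lintegral_mul _ hga (by fun_prop),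
      ← lintegral_const_mul _ (by fun_prop)]
    refine lintegral_congr fun x ↦ ?_
    simp only [Pi.mul_apply]
    ring
  have h2 : ∀ s, gammaPDF (a + b) r s *
      ∫⁻ t, f (s, t) ∂(volume.withDensity (betaPDF b a)) =
      ∫⁻ t, gammaPDF (a + b) r s * betaPDF b a t * f (s, t) := fun s ↦ by
    rw [lintegral_withDensity_eq_lintegral_mul _ hba (by fun_prop),
      ← lintegral_const_mul _ (by fun_prop)]
    refine lintegral_congr fun x ↦ ?_
    simp only [Pi.mul_apply]
    ring
  simp_rw [h1, h2]
  exact lintegral_gammaPDF_prod ha hb hr hf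

/-! ### Chi-squared laws as gamma laws -/

/-- Density identity for squaring: the factor `2` counts the preimages `± z`, and `|2 * z|` is the
Jacobian. -/
lemma gaussianPDF_zero_one_eq {z : ℝ} (hz : 0 < z) :
    2 * gaussianPDF 0 1 z = ENNReal.ofReal |2 * z| * gammaPDF (1 / 2) (1 / 2) (z ^ 2) := by
  have h2 : (2 : ℝ≥0∞) = ENNReal.ofReal 2 := by simp
  rw [gammaPDF_of_nonneg (by positivity), gaussianPDF, h2, ← ENNReal.ofReal_mul (by norm_num),
    ← ENNReal.ofReal_mul (by positivity), abs_of_pos (by positivity), gaussianPDFReal,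
    Real.Gamma_one_half_eq]
  congr 1
  have e1 : (z ^ 2) ^ ((1 : ℝ) / 2 - 1) = z⁻¹ := by
    rw [← Real.rpow_natCast, ← Real.rpow_mul hz.le, ← Real.rpow_neg_one]
    norm_num
  have e2 : ((1 : ℝ) / 2) ^ ((1 : ℝ) / 2) = (√2)⁻¹ := by
    rw [← Real.sqrt_eq_rpow, one_div, Real.sqrt_inv]
  have e3 : √(2 * Real.pi * ((1 : NNReal) : ℝ)) = √2 * √Real.pi := by
    simp
  rw [e1, e2, e3]
  have e4 : -(z - 0) ^ 2 / (2 * ((1 : NNReal) : ℝ)) = -(1 / 2 * z ^ 2) := by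
    simp; ring
  rw [e4]
  have : 0 < √Real.pi := Real.sqrt_pos.2 Real.pi_pos
  field_simp

lemma map_sq_gaussianReal :
    (gaussianReal 0 1).map (fun z ↦ z ^ 2) = gammaMeasure (1 / 2) (1 / 2) := by
  refine Measure.ext_of_lintegral _ fun f hf ↦ ?_
  have hg := measurable_gammaPDF (1 / 2) (1 / 2)
  have hφ : Measurable (gaussianPDF 0 1) := measurable_gaussianPDF 0 1
  rw [lintegral_map hf (by fun_prop), gaussianReal_of_var_ne_zero _ one_ne_zero, gammaMeasure,
    lintegral_withDensity_eq_lintegral_mul _ hφ (by fun_prop),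
    lintegral_withDensity_eq_lintegral_mul _ hg hf]
  simp only [Pi.mul_apply]
  have split : ∀ g : ℝ → ℝ≥0∞, ∫⁻ x, g x = (∫⁻ x in Set.Ioi 0, g x) + ∫⁻ x in Set.Iio 0, g x := by
    intro g
    rw [← lintegral_add_compl g (measurableSet_Ioi (a := (0 : ℝ))), Set.compl_Ioi,
      setLIntegral_congr (Iio_ae_eq_Iic (a := (0 : ℝ))).symm]
  have hneg : ∫⁻ x in Set.Iio 0, gaussianPDF 0 1 x * f (x ^ 2) =
      ∫⁻ x in Set.Ioi 0, gaussianPDF 0 1 x * f (x ^ 2) := by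
    rw [← lintegral_indicator measurableSet_Iio, ← lintegral_indicator measurableSet_Ioi,
      ← lintegral_neg_eq_self]
    refine lintegral_congr fun x ↦ ?_
    simp [Set.indicator, gaussianPDF, gaussianPDFReal]
  have hzero : ∫⁻ x in Set.Iio 0, gammaPDF (1 / 2) (1 / 2) x * f x = 0 := by
    rw [setLIntegral_congr_fun (g := fun _ ↦ 0) measurableSet_Iio
      fun x hx ↦ by rw [gammaPDF_of_neg hx, zero_mul]]
    simp
  have himg : (fun z : ℝ ↦ z ^ 2) '' Set.Ioi 0 = Set.Ioi 0 := by
    ext x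
    constructor
    · rintro ⟨z, hz, rfl⟩
      exact pow_pos (Set.mem_Ioi.1 hz) 2
    · intro hx
      exact ⟨√x, Real.sqrt_pos.2 hx, Real.sq_sqrt (le_of_lt hx)⟩
  have hsub := lintegral_image_eq_lintegral_abs_deriv_mul (s := Set.Ioi 0)
    (f := fun z : ℝ ↦ z ^ 2) (f' := fun z ↦ 2 * z) measurableSet_Ioi
    (fun x _ ↦ by simpa using (hasDerivAt_pow 2 x).hasDerivWithinAt)
    (fun x hx y hy h ↦ (pow_left_inj₀ (le_of_lt hx) (le_of_lt hy) two_ne_zero).1 h)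
    (fun x ↦ gammaPDF (1 / 2) (1 / 2) x * f x)
  rw [himg] at hsub
  rw [split, hneg, split, hzero, add_zero, hsub, ← two_mul,
    ← lintegral_const_mul' _ _ (by simp)]
  refine setLIntegral_congr_fun measurableSet_Ioi fun z hz ↦ ?_
  rw [← mul_assoc, ← mul_assoc, gaussianPDF_zero_one_eq hz]

lemma map_pi_gaussianReal_succ (n : ℕ) :
    (Measure.pi fun _ : Fin (n + 1) ↦ gaussianReal 0 1).map
        (fun z ↦ (z 0 ^ 2, ∑ i : Fin n, z i.succ ^ 2)) =
      (gammaMeasure (1 / 2) (1 / 2)).prod (chiSquared n) := by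
  have h := (measurePreserving_piFinSuccAbove (fun _ : Fin (n + 1) ↦ gaussianReal 0 1) 0).map_eq
  rw [← map_sq_gaussianReal, chiSquared, Measure.map_prod_map _ _ (by fun_prop) (by fun_prop),
    ← h, Measure.map_map (by fun_prop) (MeasurableEquiv.measurable _)]
  rfl

/-- Induction by adding one squared coordinate; additivity of gamma laws is the first marginal of
`map_gammaMeasure_prod`. The index starts at `1` since `chiSquared 0` is a Dirac mass. -/
lemma chiSquared_eq_gammaMeasure (n : ℕ) :
    chiSquared (n + 1) = gammaMeasure (((n + 1 : ℕ) : ℝ) / 2) (1 / 2) := by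
  have key : ∀ n, chiSquared (n + 1) =
      ((gammaMeasure (1 / 2) (1 / 2)).prod (chiSquared n)).map (fun p ↦ p.1 + p.2) := by
    intro n
    rw [← map_pi_gaussianReal_succ, Measure.map_map (by fun_prop) (by fun_prop), chiSquared]
    congr 1
    ext z
    simp [Fin.sum_univ_succ]
  induction n with
  | zero =>
    have : IsProbabilityMeasure (gammaMeasure (1 / 2) (1 / 2)) :=
      isProbabilityMeasure_gammaMeasure (by norm_num) (by norm_num)
    have h0 : chiSquared 0 = Measure.dirac 0 := by
      simp [chiSquared, Measure.map_const]
    rw [key, h0, Measure.prod_dirac, Measure.map_map (by fun_prop) (by fun_prop)]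
    simp [Function.comp_def]
  | succ n ih =>
    have hn : (0 : ℝ) < ((n + 1 : ℕ) : ℝ) / 2 := by positivity
    have := isProbabilityMeasureBeta hn (by norm_num : (0 : ℝ) < 1 / 2)
    have := isProbabilityMeasure_gammaMeasure
      (add_pos (by norm_num : (0 : ℝ) < 1 / 2) hn) (by norm_num : (0 : ℝ) < 1 / 2)
    have h := congrArg (Measure.map Prod.fst)
      (map_gammaMeasure_prod (by norm_num : (0 : ℝ) < 1 / 2) hn (by norm_num : (0 : ℝ) < 1 / 2))
    rw [Measure.map_map (by fun_prop) (by fun_prop), Measure.map_fst_prod, measure_univ,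
      one_smul] at h
    have e : ((n + 1 + 1 : ℕ) : ℝ) / 2 = 1 / 2 + ((n + 1 : ℕ) : ℝ) / 2 := by push_cast; ring
    rw [key, ih, e]
    exact h

/-- The squared norm of a standard Gaussian vector and the proportion of it that does not come
from the first coordinate are independent, with a chi-squared and a beta law. -/
lemma map_pi_gaussianReal_sum_sq_ratio (n : ℕ) :
    (Measure.pi fun _ : Fin (n + 2) ↦ gaussianReal 0 1).map
        (fun z ↦ (∑ i, z i ^ 2, (∑ i : Fin (n + 1), z i.succ ^ 2) / ∑ i, z i ^ 2)) =
      (chiSquared (n + 2)).prod (betaMeasure (((n + 1 : ℕ) : ℝ) / 2) (1 / 2)) := by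
  have hn : (0 : ℝ) < ((n + 1 : ℕ) : ℝ) / 2 := by positivity
  have e : ((n + 2 : ℕ) : ℝ) / 2 = 1 / 2 + ((n + 1 : ℕ) : ℝ) / 2 := by push_cast; ring
  rw [chiSquared_eq_gammaMeasure (n + 1), e,
    ← map_gammaMeasure_prod (by norm_num) hn (by norm_num), ← chiSquared_eq_gammaMeasure n,
    ← map_pi_gaussianReal_succ, Measure.map_map (by fun_prop) (by fun_prop)]
  congr 1
  ext z <;> simp [Fin.sum_univ_succ]

/-! ### Incomplete beta function, tail function and sorted distances -/

lemma betaMeasure_real_Iio {a b x : ℝ} (ha : 0 < a) (hb : 0 < b) (hx : x ≤ 1) :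
    (betaMeasure a b).real (Set.Iio x) = regIncBeta x a b := by
  have hnn : ∀ t, 0 ≤ betaPDFReal a b t := fun t ↦ by
    by_cases h : 0 < t ∧ t < 1
    · exact (betaPDFReal_pos h.1 h.2 ha hb).le
    · simp [betaPDFReal, h]
  rw [measureReal_def, betaMeasure, withDensity_apply _ measurableSet_Iio]
  have h := integral_eq_lintegral_of_nonneg_ae (μ := volume.restrict (Set.Iio x))
    (Filter.Eventually.of_forall hnn) (by fun_prop)
  change (∫⁻ t in Set.Iio x, ENNReal.ofReal (betaPDFReal a b t)).toReal = _
  rw [← h, regIncBeta, ← integral_div,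
    setIntegral_eq_of_subset_of_forall_sdiff_eq_zero (f := betaPDFReal a b) measurableSet_Iio
      (Set.Ioo_subset_Iio_self (a := 0))]
  · refine setIntegral_congr_fun measurableSet_Ioo fun t ht ↦ ?_
    simp only [betaPDFReal, if_pos (show 0 < t ∧ t < 1 from ⟨ht.1, ht.2.trans_le hx⟩)]
    ring
  · intro t ht
    have : ¬ 0 < t := fun h0 ↦ ht.2 ⟨h0, ht.1⟩
    simp [betaPDFReal, this]

lemma regIncBeta_nonneg {a b x : ℝ} (ha : 0 ≤ a) (hb : 0 ≤ b) (hx : x ≤ 1) :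
    0 ≤ regIncBeta x a b := by
  refine div_nonneg (setIntegral_nonneg measurableSet_Ioo fun t ht ↦ ?_) ?_
  · exact mul_nonneg (Real.rpow_nonneg ht.1.le _)
      (Real.rpow_nonneg (by linarith [ht.2]) _)
  · exact div_nonneg (mul_nonneg (Real.Gamma_nonneg_of_nonneg ha) (Real.Gamma_nonneg_of_nonneg hb))
      (Real.Gamma_nonneg_of_nonneg (add_nonneg ha hb))

lemma sectorI_nonneg {d : ℕ} (hd : 1 ≤ d) (x : ℝ) : 0 ≤ sectorI d x := by
  have : (1 : ℝ) ≤ d := by exact_mod_cast hd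
  exact regIncBeta_nonneg (by linarith) (by norm_num) (by nlinarith [sq_nonneg x])

instance isProbabilityMeasure_chiSquared (d : ℕ) : IsProbabilityMeasure (chiSquared d) :=
  Measure.isProbabilityMeasure_map (Measurable.aemeasurable (by fun_prop))

lemma Phi_nonneg (d : ℕ) (x : ℝ) : 0 ≤ Phi d x := cdf_nonneg _ _

lemma Phi_le_one (d : ℕ) (x : ℝ) : Phi d x ≤ 1 := cdf_le_one _ _

lemma Psi_le_one (d : ℕ) (r : ℝ) : Psi d r ≤ 1 := by
  unfold Psi
  split_ifs
  · linarith [Phi_nonneg d (r ^ 2)]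
  · exact le_rfl

lemma Psi_nonneg (d : ℕ) (r : ℝ) : 0 ≤ Psi d r := by
  unfold Psi
  split_ifs
  · linarith [Phi_le_one d (r ^ 2)]
  · exact zero_le_one

lemma Psi_antitone (d : ℕ) : Antitone (Psi d) := by
  intro x y hxy
  by_cases hx : 0 ≤ x
  · rw [Psi, Psi, if_pos hx, if_pos (hx.trans hxy)]
    have : Phi d (x ^ 2) ≤ Phi d (y ^ 2) := monotone_cdf _ (by gcongr)
    linarith
  · rw [Psi.eq_1 d x, if_neg hx]
    exact Psi_le_one d y

lemma sorted_succ {d : ℕ} (r : Fin d → ℝ) {k : ℕ} (hk : k < d) :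
    sorted r (k + 1) = r (Tuple.sort r ⟨k, hk⟩) := by
  simp [sorted, hk]

lemma sorted_mono {d : ℕ} (r : Fin d → ℝ) {k l : ℕ} (hk : 1 ≤ k) (hkl : k ≤ l) (hl : l ≤ d) :
    sorted r k ≤ sorted r l := by
  obtain ⟨k, rfl⟩ := Nat.exists_eq_add_of_le' hk
  obtain ⟨l, rfl⟩ := Nat.exists_eq_add_of_le' (hk.trans hkl)
  rw [sorted_succ r (by lia), sorted_succ r (by lia)]
  exact Tuple.monotone_sort r (by simpa using hkl)

lemma betaT_nonneg {d : ℕ} (hd : 1 ≤ d) (ybar : EuclideanSpace ℝ (Fin d))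
    (S : Matrix (Fin d) (Fin d) ℝ) : 0 ≤ betaT ybar S := by
  set ρ := sorted (mahalanobis ybar S) with hρ
  -- No sign is known for `ρ 1`, so `ρ 0 ≤ ρ 1` may fail. Replacing `Psi d (ρ 0)` by its upper bound
  -- `1` makes `q` decreasing, and the sum telescopes.
  set q : ℕ → ℝ := fun k ↦ if k = 0 then 1 else Psi d (ρ k) with hq
  suffices h : ∑ i ∈ Finset.Icc 1 d, deltaPsi d (ρ (i - 1)) (ρ i) *
      max 0 (1 - 1 / 2 * ∑ j ∈ Finset.Icc 1 (i - 1), sectorI d (ρ j / ρ i)) ≤ 1 by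
    simp only [betaT]
    linarith
  calc
    _ ≤ ∑ i ∈ Finset.Icc 1 d, (q (i - 1) - q i) := by
      refine Finset.sum_le_sum fun i hi ↦ ?_
      obtain ⟨h1, hid⟩ := Finset.mem_Icc.1 hi
      set c := max 0 (1 - 1 / 2 * ∑ j ∈ Finset.Icc 1 (i - 1), sectorI d (ρ j / ρ i))
      have hc0 : 0 ≤ c := le_max_left _ _
      have hc1 : c ≤ 1 := max_le zero_le_one (by
        linarith [Finset.sum_nonneg (s := Finset.Icc 1 (i - 1))
          fun j _ ↦ sectorI_nonneg hd (ρ j / ρ i)])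
      have hle : deltaPsi d (ρ (i - 1)) (ρ i) ≤ q (i - 1) - q i := by
        simp only [hq, deltaPsi, if_neg (show i ≠ 0 by lia)]
        split_ifs
        · linarith [Psi_le_one d (ρ (i - 1))]
        · exact le_rfl
      have hnn : 0 ≤ q (i - 1) - q i := by
        simp only [hq, if_neg (show i ≠ 0 by lia)]
        split_ifs
        · linarith [Psi_le_one d (ρ i)]
        · linarith [Psi_antitone d
            (sorted_mono (mahalanobis ybar S) (by lia) (Nat.sub_le i 1) hid)]
      exact (mul_le_mul_of_nonneg_right hle hc0).trans (mul_le_of_le_one_right hnn hc1)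
    _ = q 0 - q d := by
      have h := Finset.sum_range_sub' q d
      have h' := Finset.sum_Ico_add' (fun i ↦ q (i - 1) - q i) 0 d 1
      rw [← h, Finset.range_eq_Ico]
      exact h'.symm
    _ ≤ 1 := by
      simp only [hq, if_true, if_neg (show d ≠ 0 by lia)]
      linarith [Psi_nonneg d (ρ d)]

/-! ### Shells, cones and polyhedra under the standard Gaussian law -/

section Gaussian

variable {d : ℕ}

lemma map_norm_sq_stdGaussian :
    (stdGaussian (EuclideanSpace ℝ (Fin d))).map (fun z ↦ ‖z‖ ^ 2) = chiSquared d := by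
  rw [← map_pi_eq_stdGaussian, Measure.map_map (by fun_prop) (by fun_prop), chiSquared]
  congr 1
  ext z
  simp [EuclideanSpace.real_norm_sq_eq]

lemma stdGaussian_real_norm_sq_mem {B : Set ℝ} (hB : MeasurableSet B) :
    (stdGaussian (EuclideanSpace ℝ (Fin d))).real {z | ‖z‖ ^ 2 ∈ B} = (chiSquared d).real B := by
  rw [← map_norm_sq_stdGaussian, map_measureReal_apply (by fun_prop) hB]
  rfl

lemma exists_orthonormalBasis_zero_eq {n : ℕ} {u : EuclideanSpace ℝ (Fin (n + 1))}
    (hu : ‖u‖ = 1) :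
    ∃ b : OrthonormalBasis (Fin (n + 1)) ℝ (EuclideanSpace ℝ (Fin (n + 1))), b 0 = u := by
  obtain ⟨b, hb⟩ := Orthonormal.exists_orthonormalBasis_extension_of_card_eq (𝕜 := ℝ)
    (E := EuclideanSpace ℝ (Fin (n + 1))) (ι := Fin (n + 1)) (by simp) (v := fun _ ↦ u)
    (s := {0}) ⟨fun _ ↦ hu, fun i k hik ↦ (hik (Subsingleton.elim i k)).elim⟩
  exact ⟨b, hb 0 rfl⟩

/-- In an orthonormal basis starting with `u`, the double cone says that the share of `‖z‖ ^ 2`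
outside the first coordinate is below `1 - c ^ 2`; this share is independent of `‖z‖ ^ 2`. -/
lemma stdGaussian_real_sq_cone_le (n : ℕ) {u : EuclideanSpace ℝ (Fin (n + 2))} (hu : ‖u‖ = 1)
    {c : ℝ} {B : Set ℝ} (hB : MeasurableSet B) :
    (stdGaussian (EuclideanSpace ℝ (Fin (n + 2)))).real
        {z | ‖z‖ ^ 2 ∈ B ∧ c ^ 2 * ‖z‖ ^ 2 < ⟪u, z⟫ ^ 2} ≤
      (chiSquared (n + 2)).real B * sectorI (n + 2) c := by
  obtain ⟨b, hb⟩ := exists_orthonormalBasis_zero_eq hu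
  have hn : (0 : ℝ) < ((n + 1 : ℕ) : ℝ) / 2 := by positivity
  have := isProbabilityMeasureBeta hn (by norm_num : (0 : ℝ) < 1 / 2)
  have e : ((n + 2 : ℕ) - 1 : ℝ) / 2 = ((n + 1 : ℕ) : ℝ) / 2 := by push_cast; ring
  rw [sectorI, e, ← betaMeasure_real_Iio hn (by norm_num) (by nlinarith [sq_nonneg c]),
    ← measureReal_prod_prod, ← map_pi_gaussianReal_sum_sq_ratio,
    map_measureReal_apply (by fun_prop) (hB.prod measurableSet_Iio),
    stdGaussian_eq_map_pi_orthonormalBasis b, map_measureReal_apply (by fun_prop)]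
  · refine measureReal_mono ?_
    rintro x ⟨hxB, hx⟩
    have hnorm : ‖∑ i, x i • b i‖ ^ 2 = ∑ i, x i ^ 2 := by
      rw [← b.sum_sq_inner_right]
      simp [b.inner_eq_ite, inner_sum, inner_smul_right]
    have hinner : ⟪u, ∑ i, x i • b i⟫ = x 0 := by
      simp [← hb, b.inner_eq_ite, inner_sum, inner_smul_right]
    rw [hnorm] at hxB hx
    rw [hinner] at hx
    have hs : ∑ i, x i ^ 2 = x 0 ^ 2 + ∑ i : Fin (n + 1), x i.succ ^ 2 := Fin.sum_univ_succ _
    have hW : 0 ≤ ∑ i : Fin (n + 1), x i.succ ^ 2 := Finset.sum_nonneg fun _ _ ↦ sq_nonneg _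
    have hpos : 0 < ∑ i, x i ^ 2 := by
      have : 0 ≤ c ^ 2 * ∑ i, x i ^ 2 := by positivity
      linarith
    refine ⟨hxB, ?_⟩
    simp only [Set.mem_Iio, div_lt_iff₀ hpos]
    linarith
  · exact (measurableSet_preimage (f := fun z ↦ ‖z‖ ^ 2) (by fun_prop) hB).inter
      (measurableSet_lt (f := fun z ↦ c ^ 2 * ‖z‖ ^ 2) (g := fun z ↦ ⟪u, z⟫ ^ 2) (by fun_prop)
        (by fun_prop))

/-- The part of a shell that lies in a spherical sector. -/
lemma stdGaussian_real_cone_le (hd : 2 ≤ d) {u : EuclideanSpace ℝ (Fin d)} (hu : ‖u‖ = 1)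
    {c : ℝ} (hc : 0 ≤ c) {B : Set ℝ} (hB : MeasurableSet B) :
    (stdGaussian (EuclideanSpace ℝ (Fin d))).real {z | ‖z‖ ^ 2 ∈ B ∧ c * ‖z‖ < ⟪u, z⟫} ≤
      1 / 2 * sectorI d c * (chiSquared d).real B := by
  obtain ⟨n, rfl⟩ := Nat.exists_eq_add_of_le' hd
  set γ := stdGaussian (EuclideanSpace ℝ (Fin (n + 2)))
  set C := {z : EuclideanSpace ℝ (Fin (n + 2)) | ‖z‖ ^ 2 ∈ B ∧ c * ‖z‖ < ⟪u, z⟫}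
  have hC : MeasurableSet C := (measurableSet_preimage (f := fun z ↦ ‖z‖ ^ 2) (by fun_prop) hB).inter
    (measurableSet_lt (f := fun z ↦ c * ‖z‖) (g := fun z ↦ ⟪u, z⟫) (by fun_prop)
      (by fun_prop))
  -- The cone and its reflection have equal mass and, as `c ≥ 0`, are disjoint inside the double
  -- cone: hence the factor `1 / 2`.
  have hneg : γ.real (Neg.neg ⁻¹' C) = γ.real C := by
    conv_rhs => rw [show γ = γ.map Neg.neg from
      (stdGaussian_map (LinearIsometryEquiv.neg ℝ)).symm]
    rw [map_measureReal_apply measurable_neg hC]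
  have hdisj : Disjoint C (Neg.neg ⁻¹' C) := by
    refine Set.disjoint_left.2 fun z h1 h2 ↦ ?_
    have h3 := h1.2
    have h4 := h2.2
    rw [inner_neg_right, norm_neg] at h4
    have : 0 ≤ c * ‖z‖ := by positivity
    linarith
  have hsub : C ∪ Neg.neg ⁻¹' C ⊆ {z | ‖z‖ ^ 2 ∈ B ∧ c ^ 2 * ‖z‖ ^ 2 < ⟪u, z⟫ ^ 2} := by
    rintro z (h | h)
    · refine ⟨h.1, ?_⟩
      rw [← mul_pow]
      exact pow_lt_pow_left₀ h.2 (by positivity) two_ne_zero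
    · obtain ⟨h1, h2⟩ := h
      rw [norm_neg] at h1 h2
      rw [inner_neg_right] at h2
      refine ⟨h1, ?_⟩
      rw [← mul_pow, ← neg_sq ⟪u, z⟫]
      exact pow_lt_pow_left₀ h2 (by positivity) two_ne_zero
  have h := (measureReal_mono (μ := γ) hsub).trans (stdGaussian_real_sq_cone_le n hu hB)
  rw [measureReal_union hdisj (measurable_neg hC), hneg] at h
  linarith

lemma chiSquared_real_Ioc {R₁ R₂ : ℝ} (h0 : 0 ≤ R₁) (h : R₁ ≤ R₂) :
    (chiSquared d).real (Set.Ioc (R₁ ^ 2) (R₂ ^ 2)) = deltaPsi d R₁ R₂ := by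
  have hle : R₁ ^ 2 ≤ R₂ ^ 2 := by gcongr
  rw [deltaPsi, Psi, Psi, if_pos h0, if_pos (h0.trans h), Phi, Phi, cdf_eq_real, cdf_eq_real,
    ← Set.Iic_sdiff_Iic, measureReal_sdiff (Set.Iic_subset_Iic.2 hle) measurableSet_Iic]
  ring

/-- The bound on the probability of a polyhedron with increasing distances to its faces. -/
lemma sum_deltaPsi_le_stdGaussian_real {ρ : ℕ → ℝ} (hρ0 : ρ 0 = 0)
    (hρ : ∀ k l, k ≤ l → l ≤ d → ρ k ≤ ρ l) {v : ℕ → EuclideanSpace ℝ (Fin d)}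
    (hv : ∀ k ∈ Finset.Icc 1 d, ‖v k‖ = 1) :
    ∑ i ∈ Finset.Icc 1 d, deltaPsi d (ρ (i - 1)) (ρ i) *
        max 0 (1 - 1 / 2 * ∑ j ∈ Finset.Icc 1 (i - 1), sectorI d (ρ j / ρ i)) ≤
      (stdGaussian (EuclideanSpace ℝ (Fin d))).real
        {z | ∀ k ∈ Finset.Icc 1 d, ⟪v k, z⟫ ≤ ρ k} := by
  set γ := stdGaussian (EuclideanSpace ℝ (Fin d))
  set G := {z : EuclideanSpace ℝ (Fin d) | ∀ k ∈ Finset.Icc 1 d, ⟪v k, z⟫ ≤ ρ k}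
  set B : ℕ → Set ℝ := fun i ↦ Set.Ioc (ρ (i - 1) ^ 2) (ρ i ^ 2) with hB
  set A : ℕ → Set (EuclideanSpace ℝ (Fin d)) := fun i ↦ {z | ‖z‖ ^ 2 ∈ B i} with hA
  have hnn : ∀ k ≤ d, 0 ≤ ρ k := fun k hk ↦ hρ0 ▸ hρ 0 k (Nat.zero_le _) hk
  have hGm : MeasurableSet G := by
    simp only [G, Set.ofPred_forall]
    exact MeasurableSet.iInter fun k ↦ MeasurableSet.iInter fun _ ↦
      measurableSet_le (by fun_prop) (by fun_prop)
  have hAm : ∀ i, MeasurableSet (A i) := fun i ↦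
    measurableSet_preimage (by fun_prop) measurableSet_Ioc
  have hdisj : (↑(Finset.Icc 1 d) : Set ℕ).PairwiseDisjoint fun i ↦ G ∩ A i := by
    have aux : ∀ i k, i < k → k ≤ d → Disjoint (G ∩ A i) (G ∩ A k) := fun i k hik hk ↦ by
      refine Set.disjoint_left.2 fun z h1 h2 ↦ ?_
      have h3 : ‖z‖ ^ 2 ≤ ρ i ^ 2 := h1.2.2
      have h4 : ρ (k - 1) ^ 2 < ‖z‖ ^ 2 := h2.2.1
      have h5 : ρ i ^ 2 ≤ ρ (k - 1) ^ 2 :=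
        pow_le_pow_left₀ (hnn i (by lia)) (hρ i (k - 1) (by lia) (by lia)) 2
      linarith
    intro i hi k hk hik
    rcases lt_or_gt_of_ne hik with h | h
    · exact aux i k h (Finset.mem_Icc.1 hk).2
    · exact (aux k i h (Finset.mem_Icc.1 hi).2).symm
  calc
    _ ≤ ∑ i ∈ Finset.Icc 1 d, γ.real (G ∩ A i) := by
      refine Finset.sum_le_sum fun i hi ↦ ?_
      obtain ⟨h1, hid⟩ := Finset.mem_Icc.1 hi
      have hp : γ.real (A i) = deltaPsi d (ρ (i - 1)) (ρ i) := by
        rw [← chiSquared_real_Ioc (hnn _ (by lia)) (hρ _ _ (by lia) hid)]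
        exact stdGaussian_real_norm_sq_mem measurableSet_Ioc
      have hp' : (chiSquared d).real (B i) = deltaPsi d (ρ (i - 1)) (ρ i) :=
        chiSquared_real_Ioc (hnn _ (by lia)) (hρ _ _ (by lia) hid)
      rw [← hp, mul_max_of_nonneg _ _ measureReal_nonneg, mul_zero]
      refine max_le measureReal_nonneg ?_
      have hcover : A i ⊆ (G ∩ A i) ∪ ⋃ k ∈ Finset.Icc 1 (i - 1),
          {z | ‖z‖ ^ 2 ∈ B i ∧ ρ k / ρ i * ‖z‖ < ⟪v k, z⟫} := by
        intro z hz
        by_cases hzG : z ∈ G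
        · exact Or.inl ⟨hzG, hz⟩
        right
        obtain ⟨k, hk, hlt⟩ : ∃ k ∈ Finset.Icc 1 d, ρ k < ⟪v k, z⟫ := by
          simpa [G, and_assoc] using hzG
        obtain ⟨hk1, hkd⟩ := Finset.mem_Icc.1 hk
        have hzi : ‖z‖ ≤ ρ i := le_of_sq_le_sq hz.2 (hnn i hid)
        have hpos : 0 < ρ i := by
          have h2 : ρ (i - 1) ^ 2 < ρ i ^ 2 := hz.1.trans_le hz.2
          exact (hnn _ (by lia)).trans_lt (lt_of_pow_lt_pow_left₀ 2 (hnn i hid) h2)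
        have hinner : ⟪v k, z⟫ ≤ ‖z‖ := by
          simpa [hv k hk] using real_inner_le_norm (v k) z
        -- Otherwise `⟪v k, z⟫ ≤ ‖z‖ ≤ ρ i ≤ ρ k`, against the violation.
        have hki : k < i := by
          by_contra hki
          linarith [hρ i k (not_lt.1 hki) hkd]
        simp only [Set.mem_iUnion]
        refine ⟨k, Finset.mem_Icc.2 ⟨hk1, by lia⟩, hz, lt_of_le_of_lt ?_ hlt⟩
        rw [div_mul_eq_mul_div, div_le_iff₀ hpos]
        exact mul_le_mul_of_nonneg_left hzi (hnn k hkd)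
      have hbad : ∀ k ∈ Finset.Icc 1 (i - 1),
          γ.real {z | ‖z‖ ^ 2 ∈ B i ∧ ρ k / ρ i * ‖z‖ < ⟪v k, z⟫} ≤
            1 / 2 * sectorI d (ρ k / ρ i) * γ.real (A i) := fun k hk ↦ by
        obtain ⟨hk1, hki⟩ := Finset.mem_Icc.1 hk
        rw [hp, ← hp']
        -- An index `1 ≤ k < i ≤ d` exists only if `d ≥ 2`, as the cone bound requires.
        exact stdGaussian_real_cone_le (by lia) (hv k (Finset.mem_Icc.2 ⟨hk1, by lia⟩))
          (div_nonneg (hnn k (by lia)) (hnn i hid)) measurableSet_Ioc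
      have h := (measureReal_mono (μ := γ) hcover).trans (measureReal_union_le _ _)
      have h' := h.trans (add_le_add_right ((measureReal_biUnion_finset_le _ _).trans
        (Finset.sum_le_sum hbad)) _)
      rw [← Finset.sum_mul, ← Finset.mul_sum] at h'
      linarith
    _ = γ.real (⋃ i ∈ Finset.Icc 1 d, G ∩ A i) :=
      (measureReal_biUnion_finset hdisj fun i _ ↦ hGm.inter (hAm i)).symm
    _ ≤ γ.real G := measureReal_mono (Set.iUnion₂_subset fun _ _ ↦ Set.inter_subset_left)

/-- The bound on the probability that finitely many linear constraints hold, in any order. -/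
lemma sum_sorted_le_stdGaussian_real {r : Fin d → ℝ} (hr : ∀ i, 0 ≤ r i)
    {u : Fin d → EuclideanSpace ℝ (Fin d)} (hu : ∀ i, ‖u i‖ = 1) :
    ∑ i ∈ Finset.Icc 1 d, deltaPsi d (sorted r (i - 1)) (sorted r i) *
        max 0 (1 - 1 / 2 * ∑ j ∈ Finset.Icc 1 (i - 1), sectorI d (sorted r j / sorted r i)) ≤
      (stdGaussian (EuclideanSpace ℝ (Fin d))).real {z | ∀ i, ⟪u i, z⟫ ≤ r i} := by
  -- The shift `k - 1` matches the indexing of `sorted` from `1`.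
  set v : ℕ → EuclideanSpace ℝ (Fin d) := fun k ↦
    if h : k - 1 < d then u (Tuple.sort r ⟨k - 1, h⟩) else 0 with hv
  refine (sum_deltaPsi_le_stdGaussian_real (v := v) rfl ?_ ?_).trans (measureReal_mono ?_)
  · intro k l hkl hl
    rcases Nat.eq_zero_or_pos k with rfl | hk
    · rcases l with - | l
      · exact le_rfl
      · rw [sorted_succ r hl]
        exact hr _
    · exact sorted_mono r hk hkl hl
  · intro k hk
    obtain ⟨hk1, hkd⟩ := Finset.mem_Icc.1 hk
    simp only [hv, dif_pos (show k - 1 < d by lia), hu]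
  · intro z hz i
    obtain ⟨k, rfl⟩ := (Tuple.sort r).surjective i
    have h := hz (k + 1) (Finset.mem_Icc.2 ⟨by lia, k.2⟩)
    rw [sorted_succ r k.2] at h
    simpa [hv] using h

end Gaussian

/-! ### Reduction to the standard Gaussian law -/

-- Coordinate `i` of `A z` is `⟪A e_i, z⟫` as `A = √S` is symmetric, and `‖A e_i‖ ^ 2 = ⟪e_i, S e_i⟫
-- = S i i`; dividing by `√(S i i)` normalizes.
open scoped MatrixOrder in
lemma exists_unit_stdGaussian_real_eq {d : ℕ} (ybar : EuclideanSpace ℝ (Fin d))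
    {S : Matrix (Fin d) (Fin d) ℝ} (hS : S.PosSemidef) (hdiag : ∀ i, 0 < S i i) :
    ∃ u : Fin d → EuclideanSpace ℝ (Fin d), (∀ i, ‖u i‖ = 1) ∧
      (multivariateGaussian ybar S).real {v | ∀ i, v i ≤ 0} =
        (stdGaussian (EuclideanSpace ℝ (Fin d))).real
          {z | ∀ i, ⟪u i, z⟫ ≤ mahalanobis ybar S i} := by
  set A := Matrix.toEuclideanCLM (𝕜 := ℝ) (n := Fin d) (CFC.sqrt S) with hA
  have hadj : ContinuousLinearMap.adjoint A = A :=
    IsSelfAdjoint.adjoint_eq ((CFC.sqrt_nonneg S).isSelfAdjoint.map _)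
  set e := EuclideanSpace.basisFun (Fin d) ℝ with he
  have hcoord : ∀ i z, A z i = ⟪A (e i), z⟫ := fun i z ↦ by
    rw [← ContinuousLinearMap.adjoint_inner_right, hadj]
    rw [he, EuclideanSpace.basisFun_apply, EuclideanSpace.inner_single_left]
    simp
  have hnorm : ∀ i, ‖A (e i)‖ = √(S i i) := fun i ↦ by
    rw [@norm_eq_sqrt_real_inner]
    congr 1
    rw [← ContinuousLinearMap.adjoint_inner_right, hadj, ← mul_apply_eq_comp, hA,
      ← map_mul, CFC.sqrt_mul_sqrt_self _ hS.nonneg, Matrix.inner_toEuclideanCLM]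
    simp [he]
  have hσ : ∀ i, 0 < √(S i i) := fun i ↦ Real.sqrt_pos.2 (hdiag i)
  refine ⟨fun i ↦ (√(S i i))⁻¹ • A (e i), fun i ↦ ?_, ?_⟩
  · rw [norm_smul, hnorm, norm_inv, Real.norm_of_nonneg (hσ i).le, inv_mul_cancel₀ (hσ i).ne']
  · have hm : MeasurableSet {v : EuclideanSpace ℝ (Fin d) | ∀ i, v i ≤ 0} := by
      simp only [Set.ofPred_forall]
      exact MeasurableSet.iInter fun i ↦ measurableSet_le (by fun_prop) (by fun_prop)
    rw [multivariateGaussian, map_measureReal_apply (by fun_prop) hm]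
    congr 1
    ext z
    refine forall_congr' fun i ↦ ?_
    change ybar i + A z i ≤ 0 ↔ _
    rw [hcoord, real_inner_smul_left, mahalanobis, inv_mul_eq_div,
      div_le_div_iff_of_pos_right (hσ i)]
    constructor <;> intro h <;> linarith

end ChanceConstraint

theorem mainTheorem3 {Ω : Type*} [MeasurableSpace Ω] (P : Measure Ω) [IsProbabilityMeasure P]
    (d : ℕ) (ybar : EuclideanSpace ℝ (Fin d)) (S : Matrix (Fin d) (Fin d) ℝ)
    (hS : S.PosSemidef) (hdiag : ∀ i, 0 < S i i)
    (y : Ω → EuclideanSpace ℝ (Fin d)) (hy : HasLaw y (multivariateGaussian ybar S) P)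
    (β : ℝ) (hβ0 : 0 < β) (hβ1 : β < 1)
    (j : Fin d) (hj : ybar j ≠ 0)
    (hrisk : ChanceConstraint.betaT ybar S * |ybar j| ≤ -β * ybar j)
    (hother : ∀ i, i ≠ j → ybar i ≤ 0) :
    1 - β ≤ P.real {ω | ∀ i, y ω i ≤ 0} := by
  have hT := ChanceConstraint.betaT_nonneg (d := d) (by have := j.2; lia) ybar S
  have hneg : ybar j < 0 := by
    refine lt_of_le_of_ne (not_lt.1 fun h ↦ ?_) hj
    have h1 : 0 ≤ ChanceConstraint.betaT ybar S * |ybar j| := by positivity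
    nlinarith
  have hle : ChanceConstraint.betaT ybar S ≤ β := by
    rw [abs_of_neg hneg] at hrisk
    exact le_of_mul_le_mul_right (by linarith) (neg_pos.2 hneg)
  have hy0 : ∀ i, ybar i ≤ 0 := fun i ↦ by
    rcases eq_or_ne i j with rfl | h
    · exact hneg.le
    · exact hother i h
  obtain ⟨u, hu, hprob⟩ := ChanceConstraint.exists_unit_stdGaussian_real_eq ybar hS hdiag
  have hr : ∀ i, 0 ≤ ChanceConstraint.mahalanobis ybar S i := fun i ↦
    div_nonneg (neg_nonneg.2 (hy0 i)) (Real.sqrt_nonneg _)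
  have hm : MeasurableSet {v : EuclideanSpace ℝ (Fin d) | ∀ i, v i ≤ 0} := by
    simp only [Set.ofPred_forall]
    exact MeasurableSet.iInter fun i ↦ measurableSet_le (by fun_prop) (by fun_prop)
  have hlaw : P.real {ω | ∀ i, y ω i ≤ 0} =
      (multivariateGaussian ybar S).real {v | ∀ i, v i ≤ 0} := by
    rw [← hy.map_eq, measureReal_def, measureReal_def,
      Measure.map_apply_of_aemeasurable hy.aemeasurable hm]
    rfl
  rw [hlaw, hprob]
  have h := ChanceConstraint.sum_sorted_le_stdGaussian_real hr hu
  simp only [ChanceConstraint.betaT] at hle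
  linarith
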